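/- Let $\mathbb{S}\subset\mathbb{R}$ be a finite set and let $Y=(Y_t)_{t\ge 0}$ be a right-continuous continuous-time Markov chain with state space $\mathbb{S}$ and transition rate matrix $G$ (that is, $G(x,y)\ge 0$ for $x\ne y$ and $G(x,x)=-\sum_{y\neq x}G(x,y)$, and the transition function of $Y$ is $e^{tG}$); $\mathbb{E}_x$ denotes expectation for the chain started at $Y_0=x\in\mathbb{S}$. Let $a>0$ and $f:\mathbb{S}\to\mathbb{C}$. Define the drawdown times without recovery by $\tilde\tau_{a,0}=0$ and $$\tilde\tau_{a,n}=\inf\Big\{t>\tilde\tau_{a,n-1}:\ \sup_{\tilde\tau_{a,n-1}\le u\le t}Y_u-Y_t\ge a\Big\},\qquad n\ge 1,$$ with $\inf\emptyset=\infty$, and for $q\in\mathbb{C}$ with $\operatorname{Re} q>0$, $x\in\mathbb{S}$ and $n\ge 0$ put $$H_n(q,x)=\mathbb{E}_x\big[e^{-q\tilde\tau_{a,n}}f(Y_{\tilde\tau_{a,n}})\big],$$ where the random variable in the bracket is $0$ on $\{\tilde\tau_{a,n}=\infty\}$. For $A\subseteq\mathbb{R}$ let $T_A=\inf\{t>0: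 Y_t\notin A\}$, and for $k,g:\mathbb{S}\to\mathbb{C}$ let $$P_A(k,x;g)=\mathbb{E}_x\Big[e^{-\int_0^{T_A}k(Y_s)\,ds}\,\mathbf{1}_{\{T_A<\infty\}}\,g(Y_{T_A})\Big];$$ write $P_A(q,x;g)$ when $k\equiv q$ is constant. Proposition. Let $q\in\mathbb{C}$ with $\operatorname{Re} q>0$. All the expectations appearing below are those of integrable random variables, $H_0(q,x)=f(x)$ for every $x\in\mathbb{S}$, and for every $n\ge 1$ and every $x\in\mathbb{S}$, $$H_n(q,x)=P_{(x-a,x]}\big(q,x;\,H_{n-1}(q,\cdot)\,\mathbf{1}_{\{\cdot\le x-a\}}\big)+\sum_{y\in\mathbb{S},\,y>x}P_{(x-a,x]}\big(q,x;\,\mathbf{1}_{\{\cdot=y\}}\big)\,H_n(q,y).$$ -/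

import Mathlib

open MeasureTheory
open scoped NNReal ENNReal

/-- `G` is a transition rate matrix on the finite state space `S`: the off-diagonal entries are
nonnegative and `G x x = -∑_{y ≠ x} G x y`. -/
def IsRateMatrix {S : Finset ℝ} (G : Matrix S S ℝ) : Prop :=
  (∀ x y : S, x ≠ y → 0 ≤ G x y) ∧
    ∀ x : S, G x x = -∑ y ∈ Finset.univ.filter (fun y : S => y ≠ x), G x y

/-- A continuous-time Markov chain with finite state space `S ⊆ ℝ` and transition rate matrix `G`,
realised on a measurable space `Ω`: a right-continuous `S`-valued process `(Y_t)_{t ≥ 0}` together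
with probability measures `P x` (the law of the chain started at `x`), whose transition function
is the matrix semigroup `exp (t G)`. -/
structure MarkovChain {S : Finset ℝ} (G : Matrix S S ℝ) (Ω : Type*) [MeasurableSpace Ω] where
  /-- the law under which the chain starts at `x` -/
  P : S → Measure Ω
  isProbabilityMeasure : ∀ x, IsProbabilityMeasure (P x)
  /-- the state `Y_t` at time `t` -/
  Y : ℝ≥0 → Ω → S
  measurable_Y : ∀ t, Measurable (Y t)
  rightContinuous : ∀ ω t, ContinuousWithinAt (fun s => Y s ω) (Set.Ici t) t
  /-- the finite-dimensional distributions: for `0 = t₀ ≤ t₁ ≤ ⋯ ≤ t_m` and states `x = z₀, …, z_m`,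
  `P_x(Y_{t₀} = z₀, …, Y_{t_m} = z_m) = ∏_{i < m} exp((t_{i+1} - t_i) G)(z_i, z_{i+1})`;
  for `m = 0` this says `P_x(Y_0 = x) = 1` -/
  finiteDimensional : ∀ (x : S) (m : ℕ) (t : ℕ → ℝ≥0) (z : ℕ → S),
    Monotone t → t 0 = 0 → z 0 = x →
      (P x).real {ω | ∀ i ≤ m, Y (t i) ω = z i} =
        ∏ i ∈ Finset.range m,
          (NormedSpace.exp (((t (i + 1) : ℝ) - (t i : ℝ)) • G) : Matrix S S ℝ) (z i) (z (i + 1))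

namespace MarkovChain

variable {S : Finset ℝ} {G : Matrix S S ℝ} {Ω : Type*} [MeasurableSpace Ω]

/-- The first passage time `T_A = inf {t > 0 : Y_t ∉ A}`, with `inf ∅ = ∞`. -/
noncomputable def passageTime (M : MarkovChain G Ω) (A : Set ℝ) (ω : Ω) : ℝ≥0∞ :=
  sInf {T : ℝ≥0∞ | ∃ t : ℝ≥0, T = t ∧ 0 < t ∧ (M.Y t ω : ℝ) ∉ A}

/-- The random variable `exp(-∫_0^{T_A} k(Y_s) ds) 1_{T_A < ∞} g(Y_{T_A})`. -/
noncomputable def passagePayoff (M : MarkovChain G Ω) (A : Set ℝ) (k g : S → ℂ) (ω : Ω) : ℂ :=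
  if M.passageTime A ω < ∞ then
    Complex.exp (-∫ s in (0 : ℝ)..(M.passageTime A ω).toReal, k (M.Y s.toNNReal ω)) *
      g (M.Y (M.passageTime A ω).toNNReal ω)
  else 0

/-- The quantity `P_A(k, x; g) = E_x[exp(-∫_0^{T_A} k(Y_s) ds) 1_{T_A < ∞} g(Y_{T_A})]`. -/
noncomputable def passageExpectation (M : MarkovChain G Ω) (A : Set ℝ) (k : S → ℂ) (x : S)
    (g : S → ℂ) : ℂ :=
  ∫ ω, M.passagePayoff A k g ω ∂(M.P x)

/-- The running maximum `sup_{s ≤ u ≤ t} Y_u` over the time window `[s, t]` (used for `s ≤ t`). -/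
noncomputable def runningMax (M : MarkovChain G Ω) (s t : ℝ≥0) (ω : Ω) : ℝ :=
  sSup ((fun u => (M.Y u ω : ℝ)) '' Set.Icc s t)

/-- The `n`-th drawdown time without recovery: `τ_0 = 0` and
`τ_{n+1} = inf {t > τ_n : sup_{τ_n ≤ u ≤ t} Y_u - Y_t ≥ a}`, with `inf ∅ = ∞`. -/
noncomputable def drawdownTime (M : MarkovChain G Ω) (a : ℝ) : ℕ → Ω → ℝ≥0∞
  | 0, _ => 0
  | n + 1, ω => sInf {T : ℝ≥0∞ | ∃ t : ℝ≥0, T = t ∧ M.drawdownTime a n ω < t ∧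
      a ≤ M.runningMax (M.drawdownTime a n ω).toNNReal t ω - (M.Y t ω : ℝ)}

/-- The random variable `exp(-q τ_n) f(Y_{τ_n})`, which is `0` where `τ_n = ∞`. -/
noncomputable def drawdownPayoff (M : MarkovChain G Ω) (a : ℝ) (f : S → ℂ) (n : ℕ) (q : ℂ)
    (ω : Ω) : ℂ :=
  if M.drawdownTime a n ω < ∞ then
    Complex.exp (-(q * ((M.drawdownTime a n ω).toReal : ℂ))) *
      f (M.Y (M.drawdownTime a n ω).toNNReal ω)
  else 0

/-- The quantity `H_n(q, x) = E_x[exp(-q τ_n) f(Y_{τ_n})]`. -/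
noncomputable def drawdownExpectation (M : MarkovChain G Ω) (a : ℝ) (f : S → ℂ) (n : ℕ) (q : ℂ)
    (x : S) : ℂ :=
  ∫ ω, M.drawdownPayoff a f n q ω ∂(M.P x)

end MarkovChain

/-!
The chain started at `x` is followed until it leaves the window `(x - a, x]`. Before that time no
drawdown of size `a` can have occurred, since the path has neither exceeded `x` nor fallen to
`x - a`. If the chain leaves the window downwards, the exit time is the first drawdown time, and `n`
drawdowns of the shifted path remain. If it leaves upwards, the path is at a strict new maximum, so
that everything before is irrelevant for drawdowns and all `n + 1` drawdowns of the shifted path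
remain. The strong Markov property at the exit time turns this pathwise dichotomy into the linear
system.

The exit time `σ` is only an optional time, so the strong Markov property is obtained by letting the
grid points strictly above `σ` decrease to `σ`. At a grid point it is the Markov property at a fixed
time; and as a right-continuous path in a discrete space is constant just after `σ`, the indicators
of the finite cylinders, as seen from the grid points, are eventually equal to those seen from `σ`.
-/

section Sequences

variable {α : Type*}

/-- The sequence `u 0, …, u (m - 1), v 0, v 1, …`. -/
def splice (m : ℕ) (u v : ℕ → α) (i : ℕ) : α :=
  if i < m then u i else v (i - m)

lemma splice_add (m : ℕ) (u v : ℕ → α) (i : ℕ) : splice m u v (m + i) = v i := by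
  simp [splice]

lemma splice_of_le {m : ℕ} {u v : ℕ → α} (h : v 0 = u m) {i : ℕ} (hi : i ≤ m) :
    splice m u v i = u i := by
  rcases hi.lt_or_eq with hlt | rfl
  · exact if_pos hlt
  · simpa [h] using splice_add i u v 0

lemma monotone_splice [Preorder α] {m : ℕ} {u v : ℕ → α} (hu : Monotone u) (hv : Monotone v)
    (h : v 0 = u m) : Monotone (splice m u v) := by
  refine monotone_nat_of_le_succ fun i => ?_
  rcases lt_or_ge i m with hi | hi
  · rw [splice_of_le h hi.le, splice_of_le h hi]
    exact hu i.le_succ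
  · obtain ⟨j, rfl⟩ := Nat.exists_eq_add_of_le hi
    rw [add_assoc, splice_add, splice_add]
    exact hv j.le_succ

lemma forall_le_add_iff {p : ℕ → Prop} {m l : ℕ} :
    (∀ i ≤ m + l, p i) ↔ (∀ i ≤ m, p i) ∧ ∀ j ≤ l, p (m + j) := by
  refine ⟨fun h => ⟨fun i hi => h i (by omega), fun j hj => h _ (by omega)⟩, fun h i hi => ?_⟩
  rcases le_total i m with him | him
  · exact h.1 i him
  · obtain ⟨j, rfl⟩ := Nat.exists_eq_add_of_le him
    exact h.2 j (by omega)

lemma exists_monotone_enumeration [LinearOrder α] {J : Finset α} {a b : α}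
    (ha : IsLeast (J : Set α) a) (hb : IsGreatest (J : Set α) b) :
    ∃ (m : ℕ) (t : ℕ → α), Monotone t ∧ t 0 = a ∧ t m = b ∧ ∀ s, s ∈ J ↔ ∃ i ≤ m, t i = s := by
  have hcard : 0 < J.card := Finset.card_pos.2 ⟨a, ha.1⟩
  let t : ℕ → α := fun i => J.orderEmbOfFin rfl ⟨min i (J.card - 1), by omega⟩
  have ht : Monotone t := fun i j hij => (J.orderEmbOfFin rfl).monotone (by
    simp only [Fin.mk_le_mk]
    omega)
  have htJ : ∀ i, t i ∈ J := fun i => J.orderEmbOfFin_mem rfl _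
  have hmem : ∀ s, s ∈ J ↔ ∃ i ≤ J.card - 1, t i = s := by
    refine fun s => ⟨fun hs => ?_, fun ⟨i, _, hi⟩ => hi ▸ htJ i⟩
    obtain ⟨i, rfl⟩ : s ∈ Set.range (J.orderEmbOfFin rfl) := by rwa [J.range_orderEmbOfFin rfl]
    have hi : min (i : ℕ) (J.card - 1) = i := by omega
    exact ⟨i, by omega, by simp only [t, hi]⟩
  obtain ⟨i, -, hi⟩ := (hmem a).1 ha.1
  obtain ⟨j, hj, hjb⟩ := (hmem b).1 hb.1
  exact ⟨J.card - 1, t, ht, le_antisymm (hi ▸ ht i.zero_le) (ha.2 (htJ 0)),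
    le_antisymm (hb.2 (htJ _)) (hjb ▸ ht hj), hmem⟩

end Sequences

section Cylinders

variable {ι Ω E : Type*}

/-- The events that fix the states of the process `Y` at finitely many times in `I`. -/
def finiteCylinders (Y : ι → Ω → E) (I : Set ι) : Set (Set Ω) :=
  {C | ∃ (J : Finset ι) (z : ι → E), ↑J ⊆ I ∧ C = {ω | ∀ i ∈ J, Y i ω = z i}}

lemma isPiSystem_finiteCylinders (Y : ι → Ω → E) (I : Set ι) :
    IsPiSystem (finiteCylinders Y I) := by
  classical
  rintro _ ⟨J, z, hJ, rfl⟩ _ ⟨J', z', hJ', rfl⟩ ⟨ω₀, h, h'⟩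
  refine ⟨J ∪ J', fun i => Y i ω₀, by simp [hJ, hJ'], ?_⟩
  ext ω
  simp only [Set.mem_inter_iff, Set.mem_ofPred_eq, Finset.mem_union, or_imp, forall_and]
  exact and_congr (forall₂_congr fun i hi => by rw [h i hi])
    (forall₂_congr fun i hi => by rw [h' i hi])

lemma measurableSet_of_mem_finiteCylinders [MeasurableSpace Ω] [MeasurableSpace E]
    [DiscreteMeasurableSpace E] {Y : ι → Ω → E} {I : Set ι} (hY : ∀ i ∈ I, Measurable (Y i))
    {C : Set Ω} (hC : C ∈ finiteCylinders Y I) : MeasurableSet C := by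
  obtain ⟨J, z, hJ, rfl⟩ := hC
  have hset : {ω | ∀ i ∈ J, Y i ω = z i} = ⋂ i ∈ J, Y i ⁻¹' {z i} := by
    ext ω
    simp
  rw [hset]
  exact J.measurableSet_biInter fun i hi => hY i (hJ hi) .of_discrete

lemma iSup_comap_eq_generateFrom_finiteCylinders [MeasurableSpace E] [Countable E]
    [DiscreteMeasurableSpace E] (Y : ι → Ω → E) (I : Set ι) :
    ⨆ i ∈ I, MeasurableSpace.comap (Y i) inferInstance =
      MeasurableSpace.generateFrom (finiteCylinders Y I) := by
  refine le_antisymm (iSup₂_le fun i hi => ?_) (MeasurableSpace.generateFrom_le fun C hC => ?_)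
  · have hmeas : @Measurable Ω E (MeasurableSpace.generateFrom (finiteCylinders Y I)) _ (Y i) :=
      @measurable_to_countable' E Ω _ _ (MeasurableSpace.generateFrom _) _ fun y =>
        MeasurableSpace.measurableSet_generateFrom
          ⟨{i}, fun _ => y, by simpa using hi, by ext; simp⟩
    exact hmeas.comap_le
  · let _ : MeasurableSpace Ω := ⨆ i ∈ I, MeasurableSpace.comap (Y i) inferInstance
    exact measurableSet_of_mem_finiteCylinders
      (fun i hi => Measurable.of_comap_le (le_iSup₂_of_le i hi le_rfl)) hC

end Cylinders

section NextGridPoint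

open Filter Topology

/-- The smallest multiple of `1 / (k + 1)` that is larger than `t`. -/
noncomputable def nextGridPoint (k : ℕ) (t : ℝ≥0) : ℝ≥0 :=
  ((⌊t * (k + 1)⌋₊ : ℝ≥0) + 1) / (k + 1)

lemma lt_nextGridPoint (k : ℕ) (t : ℝ≥0) : t < nextGridPoint k t := by
  rw [nextGridPoint, lt_div_iff₀ (by positivity)]
  exact Nat.lt_floor_add_one _

lemma nextGridPoint_le (k : ℕ) (t : ℝ≥0) : nextGridPoint k t ≤ t + 1 / (k + 1) := by
  rw [nextGridPoint, add_div]
  gcongr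
  rw [div_le_iff₀ (by positivity)]
  exact Nat.floor_le zero_le

lemma tendsto_nextGridPoint (t : ℝ≥0) :
    Tendsto (fun k => nextGridPoint k t) atTop (𝓝[>] t) := by
  refine tendsto_nhdsWithin_iff.2 ⟨?_, Eventually.of_forall fun k => lt_nextGridPoint k t⟩
  have hmesh : Tendsto (fun k : ℕ => t + 1 / ((k : ℝ≥0) + 1)) atTop (𝓝 t) := by
    simpa using tendsto_const_nhds.add (tendsto_one_div_add_atTop_nhds_zero_nat (𝕜 := ℝ≥0))
  exact tendsto_of_tendsto_of_tendsto_of_le_of_le tendsto_const_nhds hmesh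
    (fun k => (lt_nextGridPoint k t).le) fun k => nextGridPoint_le k t

lemma measurable_nextGridPoint (k : ℕ) : Measurable (nextGridPoint k) := by
  unfold nextGridPoint
  fun_prop

end NextGridPoint

/-- The right-continuous paths in `E`, with the σ-algebra generated by the coordinates. -/
abbrev RightContinuousPath (E : Type*) [TopologicalSpace E] : Type _ :=
  {w : ℝ≥0 → E // ∀ t, ContinuousWithinAt w (Set.Ici t) t}

namespace RightContinuousPath

open Filter Topology

variable {E : Type*} [TopologicalSpace E]

/-! ### Right-continuous paths -/

section Shift

/-- The path `w` as seen from time `s` on. -/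
def shift (s : ℝ≥0) (w : RightContinuousPath E) : RightContinuousPath E :=
  ⟨fun t => w.1 (s + t), fun t =>
    (w.2 (s + t)).comp (continuous_const.add continuous_id).continuousWithinAt
      fun _ hu => add_le_add_right (Set.mem_Ici.1 hu) s⟩

@[simp]
lemma shift_apply (s t : ℝ≥0) (w : RightContinuousPath E) : (shift s w).1 t = w.1 (s + t) := rfl

lemma shift_shift (s t : ℝ≥0) (w : RightContinuousPath E) :
    shift t (shift s w) = shift (s + t) w := by
  ext u
  simp [add_assoc]

end Shift

section Discrete

variable [DiscreteTopology E]

lemma eventually_eq (w : RightContinuousPath E) (t : ℝ≥0) : ∀ᶠ u in 𝓝[≥] t, w.1 u = w.1 t :=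
  (w.2 t).eventually (mem_nhds_discrete.2 rfl : {w.1 t} ∈ 𝓝 (w.1 t))

lemma exists_denseSeq_apply_eq (w : RightContinuousPath E) {t : ℝ≥0} {c : ℝ≥0∞} (htc : t < c) :
    ∃ i, t < TopologicalSpace.denseSeq ℝ≥0 i ∧ (TopologicalSpace.denseSeq ℝ≥0 i : ℝ≥0∞) < c ∧
      w.1 (TopologicalSpace.denseSeq ℝ≥0 i) = w.1 t := by
  obtain ⟨d, htd, hd⟩ := mem_nhdsGE_iff_exists_Ico_subset.1 (w.eventually_eq t)
  obtain ⟨c', htc', hc'⟩ := ENNReal.lt_iff_exists_nnreal_btwn.1 htc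
  obtain ⟨i, htu, hu⟩ := (TopologicalSpace.denseRange_denseSeq ℝ≥0).exists_mem_open
    isOpen_Ioo (Set.nonempty_Ioo.2 (lt_min htd (ENNReal.coe_lt_coe.1 htc')))
  exact ⟨i, htu, (ENNReal.coe_lt_coe.2 (hu.trans_le (min_le_right _ _))).trans hc',
    hd ⟨htu.le, hu.trans_le (min_le_left _ _)⟩⟩

lemma eventually_apply_nextGridPoint_add (w : RightContinuousPath E) (s i : ℝ≥0) :
    ∀ᶠ k in atTop, w.1 (nextGridPoint k s + i) = w.1 (s + i) := by
  simpa only [shift_apply, add_comm i] using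
    ((tendsto_nextGridPoint s).mono_right (nhdsWithin_mono _ Set.Ioi_subset_Ici_self)).eventually
      ((shift i w).eventually_eq s)

lemma eventually_shift_nextGridPoint_mem_iff {C : Set (RightContinuousPath E)}
    (hC : C ∈ finiteCylinders (fun s w => w.1 s) Set.univ) (w : RightContinuousPath E) (s : ℝ≥0) :
    ∀ᶠ k in atTop, shift (nextGridPoint k s) w ∈ C ↔ shift s w ∈ C := by
  obtain ⟨J, z, -, rfl⟩ := hC
  filter_upwards [(eventually_all_finset J).2 fun i _ =>
    w.eventually_apply_nextGridPoint_add s i] with k hk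
  exact forall₂_congr fun i hi => by rw [shift_apply, shift_apply, hk i hi]

end Discrete

section Measurability

variable [MeasurableSpace E]

lemma measurable_coord (t : ℝ≥0) : Measurable fun w : RightContinuousPath E => w.1 t :=
  (measurable_pi_apply t).comp measurable_subtype_coe

lemma measurableSet_apply_eq [DiscreteMeasurableSpace E] (t : ℝ≥0) (y : E) :
    MeasurableSet {w : RightContinuousPath E | w.1 t = y} :=
  measurable_coord t (.of_discrete (s := {y}))

lemma measurableSpace_eq_generateFrom [DiscreteMeasurableSpace E] [Countable E] :
    (Subtype.instMeasurableSpace : MeasurableSpace (RightContinuousPath E)) =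
      .generateFrom (finiteCylinders (fun t w => w.1 t) Set.univ) := by
  rw [← iSup_comap_eq_generateFrom_finiteCylinders]
  simp only [Set.mem_univ, iSup_pos]
  change MeasurableSpace.comap _ (⨆ t, _) = _
  simp only [MeasurableSpace.comap_iSup, MeasurableSpace.comap_comp, Function.comp_def]

lemma measure_inter_preimage_eq_mul_of_finiteCylinders [DiscreteMeasurableSpace E]
    [Countable E] {Ω : Type*} [MeasurableSpace Ω] {μ : Measure Ω} [IsFiniteMeasure μ]
    {ν : Measure (RightContinuousPath E)} [IsProbabilityMeasure ν]
    {θ : Ω → RightContinuousPath E} (hθ : Measurable θ) {B : Set Ω}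
    (h : ∀ C ∈ finiteCylinders (fun s w => w.1 s) Set.univ, μ (B ∩ θ ⁻¹' C) = μ B * ν C)
    {C : Set (RightContinuousPath E)} (hC : MeasurableSet C) :
    μ (B ∩ θ ⁻¹' C) = μ B * ν C := by
  have hmap : ∀ C, MeasurableSet C → (μ.restrict B).map θ C = μ (B ∩ θ ⁻¹' C) := fun C hC => by
    rw [Measure.map_apply hθ hC, Measure.restrict_apply (hθ hC), Set.inter_comm]
  suffices hlaw : (μ.restrict B).map θ = μ B • ν by
    rw [← hmap C hC, hlaw]
    rfl
  refine ext_of_generate_finite _ measurableSpace_eq_generateFrom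
    (isPiSystem_finiteCylinders _ _) (fun C hC => ?_) (by simp [hmap])
  rw [hmap C (measurableSet_of_mem_finiteCylinders (fun t _ => measurable_coord t) hC), h C hC]
  rfl

variable [DiscreteTopology E] [DiscreteMeasurableSpace E]

lemma measurable_apply {σ : RightContinuousPath E → ℝ≥0} (hσ : Measurable σ) :
    Measurable fun w : RightContinuousPath E => w.1 (σ w) := by
  refine measurable_of_tendsto_metrizable
    (f := fun k (w : RightContinuousPath E) => w.1 (nextGridPoint k (σ w))) (fun k => ?_)
    (tendsto_pi_nhds.2 fun w => ?_)
  · exact (measurable_from_prod_countable_right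
      (f := fun p : ℕ × RightContinuousPath E => p.2.1 (((p.1 : ℝ≥0) + 1) / (k + 1)))
      fun j => measurable_coord (((j : ℝ≥0) + 1) / (k + 1))).comp
      ((Nat.measurable_floor.comp (hσ.mul_const _)).prodMk measurable_id)
  · exact (w.2 (σ w)).tendsto.comp
      ((tendsto_nextGridPoint _).mono_right (nhdsWithin_mono _ Set.Ioi_subset_Ici_self))

lemma measurable_shift {σ : RightContinuousPath E → ℝ≥0} (hσ : Measurable σ) :
    Measurable fun w => shift (σ w) w :=
  (measurable_pi_lambda _ fun t => measurable_apply (hσ.add_const t)).subtype_mk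

variable [Countable E]

/-- The natural filtration of the coordinate process. -/
noncomputable def coordFiltration :
    Filtration ℝ≥0 (inferInstance : MeasurableSpace (RightContinuousPath E)) :=
  Filtration.natural (fun t w => w.1 t) fun t => (measurable_coord t).stronglyMeasurable

end Measurability

/-! ### Markov families and the strong Markov property -/

section OptionalTime

variable [MeasurableSpace E] [DiscreteTopology E] [DiscreteMeasurableSpace E] [Countable E]

lemma coordFiltration_eq_generateFrom (t : ℝ≥0) :
    coordFiltration t = MeasurableSpace.generateFrom
      (finiteCylinders (fun s (w : RightContinuousPath E) => w.1 s) (Set.Iic t)) := by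
  rw [← iSup_comap_eq_generateFrom_finiteCylinders]
  rfl

lemma measurable_coord_coordFiltration {s t : ℝ≥0} (hst : s ≤ t) :
    Measurable[coordFiltration t] fun w : RightContinuousPath E => w.1 s :=
  Measurable.of_comap_le (le_iSup₂_of_le s hst le_rfl)

/-- An optional time of the natural filtration of the coordinate process: `σ < c` is decided by
the path up to time `c`. -/
def IsOptionalTime (σ : RightContinuousPath E → ℝ≥0∞) : Prop :=
  ∀ c : ℝ≥0, MeasurableSet[coordFiltration c] {w | σ w < c}

variable {σ : RightContinuousPath E → ℝ≥0∞}

lemma IsOptionalTime.measurableSet_inter (hσ : IsOptionalTime σ) {I : Set ℝ≥0∞}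
    (hI : MeasurableSet I) (c : ℝ≥0) :
    MeasurableSet[coordFiltration c] {w | σ w ∈ I ∧ σ w < c} := by
  have hmin : Measurable[coordFiltration c] fun w => min (σ w) c := by
    refine measurable_of_Iio (mδ := coordFiltration c) fun b => ?_
    rcases le_or_gt b c with hbc | hcb
    · have hset : (fun w => min (σ w) c) ⁻¹' Set.Iio b = {w | σ w < b} := by
        ext w
        simp [hbc.not_gt]
      lift b to ℝ≥0 using (hbc.trans_lt ENNReal.coe_lt_top).ne
      rw [hset]
      exact coordFiltration.mono (ENNReal.coe_le_coe.1 hbc) _ (hσ b)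
    · have hset : (fun w => min (σ w) c) ⁻¹' Set.Iio b = Set.univ := by
        ext w
        simp [hcb]
      rw [hset]
      exact MeasurableSet.univ
  have hset : {w | σ w ∈ I ∧ σ w < c} = (fun w => min (σ w) c) ⁻¹' I ∩ {w | σ w < c} := by
    ext w
    refine and_congr_left fun hw : σ w < c => ?_
    simp [min_eq_left hw.le]
  rw [hset]
  exact (hmin hI).inter (hσ c)

lemma IsOptionalTime.measurable (hσ : IsOptionalTime σ) : Measurable σ := by
  refine measurable_of_Iio fun c => ?_
  have hset : σ ⁻¹' Set.Iio c = ⋃ n : ℕ, {w | σ w ∈ Set.Iio c ∧ σ w < (n : ℝ≥0)} := by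
    ext w
    simp only [Set.mem_preimage, Set.mem_iUnion, Set.mem_ofPred_eq, exists_and_left]
    refine (and_iff_left_of_imp fun hw => ?_).symm
    simpa using ENNReal.exists_nat_gt (hw.trans_le le_top).ne
  rw [hset]
  exact .iUnion fun n => coordFiltration.le _ _ (hσ.measurableSet_inter measurableSet_Iio n)

lemma IsOptionalTime.measurableSet_floor_eq (hσ : IsOptionalTime σ) {I : Set ℝ≥0∞}
    (hI : MeasurableSet I) (htop : ∞ ∉ I) (k j : ℕ) :
    MeasurableSet[coordFiltration ((j + 1) / (k + 1) : ℝ≥0)]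
      {w | σ w ∈ I ∧ ⌊(σ w).toNNReal * (k + 1)⌋₊ = j} := by
  let cell : Set ℝ≥0∞ := I ∩ {c | ⌊c.toNNReal * (k + 1)⌋₊ = j}
  have hcell : MeasurableSet cell :=
    hI.inter (Nat.measurable_floor.comp (ENNReal.measurable_toNNReal.mul_const _)
      (measurableSet_singleton j))
  have hlt : ∀ c ∈ cell, c < ((j + 1) / (k + 1) : ℝ≥0) := by
    rintro c ⟨hcI, rfl⟩
    rw [← ENNReal.coe_toNNReal (ne_of_mem_of_not_mem hcI htop)]
    exact ENNReal.coe_lt_coe.2 (lt_nextGridPoint k c.toNNReal)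
  have hset : {w | σ w ∈ I ∧ ⌊(σ w).toNNReal * (k + 1)⌋₊ = j} =
      {w | σ w ∈ cell ∧ σ w < ((j + 1) / (k + 1) : ℝ≥0)} :=
    Set.ext fun w => (and_iff_left_of_imp (hlt (σ w))).symm
  rw [hset]
  exact hσ.measurableSet_inter hcell _

end OptionalTime

section MarkovFamily

variable [MeasurableSpace E] [DiscreteTopology E] [DiscreteMeasurableSpace E] [Countable E]

/-- The laws `Q x` of a time-homogeneous Markov process with right-continuous paths started at `x`,
in a discrete state space. -/
structure IsMarkovFamily (Q : E → Measure (RightContinuousPath E)) : Prop where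
  isProbabilityMeasure : ∀ x, IsProbabilityMeasure (Q x)
  ae_start : ∀ x, ∀ᵐ w ∂Q x, w.1 0 = x
  markov : ∀ x y t {A C}, MeasurableSet[coordFiltration t] A → MeasurableSet C →
    Q x (A ∩ {w | w.1 t = y} ∩ shift t ⁻¹' C) = Q x (A ∩ {w | w.1 t = y}) * Q y C

lemma isMarkovFamily_of_finiteCylinders {Q : E → Measure (RightContinuousPath E)}
    (hprob : ∀ x, IsProbabilityMeasure (Q x)) (hstart : ∀ x, ∀ᵐ w ∂Q x, w.1 0 = x)
    (hmarkov : ∀ x y t, ∀ A ∈ finiteCylinders (fun s w => w.1 s) (Set.Iic t),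
      ∀ C ∈ finiteCylinders (fun s w => w.1 s) Set.univ,
        Q x (A ∩ {w | w.1 t = y} ∩ shift t ⁻¹' C) = Q x (A ∩ {w | w.1 t = y}) * Q y C) :
    IsMarkovFamily Q := by
  refine ⟨hprob, hstart, fun x y t A C hA hC => ?_⟩
  have hcylinder : ∀ A ∈ finiteCylinders (fun s w => w.1 s) (Set.Iic t),
      Q x (A ∩ {w | w.1 t = y} ∩ shift t ⁻¹' C) = Q x (A ∩ {w | w.1 t = y}) * Q y C :=
    fun A hA => measure_inter_preimage_eq_mul_of_finiteCylinders (measurable_shift measurable_const)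
      (hmarkov x y t A hA) hC
  have hμ : ∀ A, MeasurableSet A → (Q x).restrict ({w | w.1 t = y} ∩ shift t ⁻¹' C) A =
      Q x (A ∩ {w | w.1 t = y} ∩ shift t ⁻¹' C) := fun A hA => by
    rw [Measure.restrict_apply hA, Set.inter_assoc]
  have hν : ∀ A, MeasurableSet A → (Q y C • (Q x).restrict {w | w.1 t = y}) A =
      Q x (A ∩ {w | w.1 t = y}) * Q y C := fun A hA => by
    rw [Measure.smul_apply, Measure.restrict_apply hA, smul_eq_mul, mul_comm]
  have huniv : Set.univ ∈ finiteCylinders (fun s (w : RightContinuousPath E) => w.1 s)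
      (Set.Iic t) := ⟨∅, fun _ => y, by simp⟩
  rw [← hμ A (coordFiltration.le t A hA), ← hν A (coordFiltration.le t A hA)]
  refine ext_on_measurableSpace_of_generate_finite _ _ (fun A hA => ?_) (coordFiltration.le t)
    (coordFiltration_eq_generateFrom t) (isPiSystem_finiteCylinders _ _) ?_ hA
  · have hAmeas := measurableSet_of_mem_finiteCylinders (fun s _ => measurable_coord s) hA
    rw [hμ A hAmeas, hν A hAmeas, hcylinder A hA]
  · rw [hμ _ .univ, hν _ .univ, hcylinder _ huniv]

end MarkovFamily

section StrongMarkov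

variable [MeasurableSpace E] [DiscreteTopology E] [DiscreteMeasurableSpace E] [Countable E]
  {Q : E → Measure (RightContinuousPath E)} {σ : RightContinuousPath E → ℝ≥0∞}

lemma IsMarkovFamily.markov_iUnion (hQ : IsMarkovFamily Q) (x y : E) {t : ℕ → ℝ≥0}
    {A : ℕ → Set (RightContinuousPath E)} (hA : ∀ j, MeasurableSet[coordFiltration (t j)] (A j))
    (hdisj : Pairwise (Function.onFun Disjoint A))
    {C : Set (RightContinuousPath E)} (hC : MeasurableSet C) :
    Q x (⋃ j, A j ∩ {w | w.1 (t j) = y} ∩ shift (t j) ⁻¹' C) =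
      Q x (⋃ j, A j ∩ {w | w.1 (t j) = y}) * Q y C := by
  have hmeas : ∀ j, MeasurableSet (A j ∩ {w | w.1 (t j) = y}) := fun j =>
    (coordFiltration.le _ _ (hA j)).inter (measurableSet_apply_eq (t j) y)
  rw [measure_iUnion, measure_iUnion, ← ENNReal.tsum_mul_right]
  · exact tsum_congr fun j => hQ.markov x y (t j) (hA j) hC
  · exact fun i j hij => (hdisj hij).mono Set.inter_subset_left Set.inter_subset_left
  · exact hmeas
  · exact fun i j hij => (hdisj hij).mono (fun _ h => h.1.1) fun _ h => h.1.1
  · exact fun j => (hmeas j).inter (measurable_shift measurable_const hC)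

lemma IsMarkovFamily.strong_markov_nextGridPoint (hQ : IsMarkovFamily Q) (hσ : IsOptionalTime σ)
    (k : ℕ) (x y : E) {I : Set ℝ≥0∞} (hI : MeasurableSet I) (htop : ∞ ∉ I)
    {C : Set (RightContinuousPath E)} (hC : MeasurableSet C) :
    Q x ({w | σ w ∈ I ∧ w.1 (nextGridPoint k (σ w).toNNReal) = y} ∩
        (fun w => shift (nextGridPoint k (σ w).toNNReal) w) ⁻¹' C) =
      Q x {w | σ w ∈ I ∧ w.1 (nextGridPoint k (σ w).toNNReal) = y} * Q y C := by
  let cell (j : ℕ) : Set (RightContinuousPath E) :=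
    {w | σ w ∈ I ∧ ⌊(σ w).toNNReal * (k + 1)⌋₊ = j}
  let t (j : ℕ) : ℝ≥0 := (j + 1) / (k + 1)
  have hgrid : ∀ j, ∀ w ∈ cell j, nextGridPoint k (σ w).toNNReal = t j := by
    rintro _ w ⟨-, rfl⟩
    rfl
  have hdisj : Pairwise (Function.onFun Disjoint cell) := fun i j hij =>
    Set.disjoint_left.2 fun w hi hj => hij (hi.2.symm.trans hj.2)
  have hunion : ∀ D, {w | σ w ∈ I ∧ w.1 (nextGridPoint k (σ w).toNNReal) = y} ∩
      (fun w => shift (nextGridPoint k (σ w).toNNReal) w) ⁻¹' D =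
        ⋃ j, cell j ∩ {w | w.1 (t j) = y} ∩ shift (t j) ⁻¹' D := by
    refine fun D => Set.ext fun w => Iff.trans ⟨fun h => ?_, ?_⟩ Set.mem_iUnion.symm
    · exact ⟨⌊(σ w).toNNReal * (k + 1)⌋₊, ⟨⟨h.1.1, rfl⟩, h.1.2⟩, h.2⟩
    · rintro ⟨j, ⟨hj, hy⟩, hD⟩
      refine ⟨⟨hj.1, ?_⟩, ?_⟩
      · rwa [hgrid j _ hj]
      · rwa [Set.mem_preimage, hgrid j _ hj]
  have hstate := hunion Set.univ
  simp only [Set.preimage_univ, Set.inter_univ] at hstate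
  rw [hunion C, hstate, hQ.markov_iUnion x y
    (fun j => hσ.measurableSet_floor_eq hI htop k j) hdisj hC]

lemma IsMarkovFamily.strong_markov (hQ : IsMarkovFamily Q) (hσ : IsOptionalTime σ) (x y : E)
    {I : Set ℝ≥0∞} (hI : MeasurableSet I) (htop : ∞ ∉ I) {C : Set (RightContinuousPath E)}
    (hC : MeasurableSet C) :
    Q x ({w | σ w ∈ I ∧ w.1 (σ w).toNNReal = y} ∩ (fun w => shift (σ w).toNNReal w) ⁻¹' C) =
      Q x {w | σ w ∈ I ∧ w.1 (σ w).toNNReal = y} * Q y C := by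
  have := hQ.isProbabilityMeasure
  have hgrid : ∀ k, Measurable fun w => nextGridPoint k (σ w).toNNReal := fun k =>
    (measurable_nextGridPoint k).comp hσ.measurable.ennreal_toNNReal
  refine measure_inter_preimage_eq_mul_of_finiteCylinders
    (measurable_shift hσ.measurable.ennreal_toNNReal) ?_ hC
  intro C hC
  have hCmeas := measurableSet_of_mem_finiteCylinders (fun t _ => measurable_coord t) hC
  have hB : ∀ k, MeasurableSet {w | σ w ∈ I ∧ w.1 (nextGridPoint k (σ w).toNNReal) = y} :=
    fun k => (hσ.measurable hI).inter (measurable_apply (hgrid k) (.of_discrete (s := {y})))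
  have hstate : ∀ w : RightContinuousPath E, ∀ᶠ k in atTop,
      w.1 (nextGridPoint k (σ w).toNNReal) = w.1 (σ w).toNNReal := fun w => by
    simpa using w.eventually_apply_nextGridPoint_add (σ w).toNNReal 0
  have hlim := tendsto_measure_of_tendsto_indicator_of_isFiniteMeasure atTop (Q x) hB fun w => by
    filter_upwards [hstate w] with k hk
    exact and_congr_right fun _ => by rw [hk]
  refine tendsto_nhds_unique ?_
    (ENNReal.Tendsto.mul_const hlim (.inr (measure_ne_top (Q y) C)))
  simp only [← hQ.strong_markov_nextGridPoint hσ _ x y hI htop hCmeas]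
  refine tendsto_measure_of_tendsto_indicator_of_isFiniteMeasure atTop (Q x)
    (fun k => (hB k).inter (measurable_shift (hgrid k) hCmeas)) fun w => ?_
  filter_upwards [hstate w, eventually_shift_nextGridPoint_mem_iff hC w _] with k hk hkC
  exact and_congr (and_congr_right fun _ => by rw [hk]) hkC

end StrongMarkov

section Discounted

variable {q : ℂ} {σ : RightContinuousPath E → ℝ≥0∞} {F : RightContinuousPath E → ℂ}

/-- The random variable `exp(-q σ) F`, with `F` evaluated at the path as seen from time `σ` on; it
is `0` where `σ = ∞`. -/
noncomputable def discounted (q : ℂ) (σ : RightContinuousPath E → ℝ≥0∞)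
    (F : RightContinuousPath E → ℂ) (w : RightContinuousPath E) : ℂ :=
  if σ w < ∞ then Complex.exp (-(q * ((σ w).toReal : ℂ))) * F (shift (σ w).toNNReal w) else 0

/-- The event that `σ` is finite and the path is in the state `y` at time `σ`. -/
def stoppedAt (σ : RightContinuousPath E → ℝ≥0∞) (y : E) : Set (RightContinuousPath E) :=
  {w | σ w < ∞ ∧ w.1 (σ w).toNNReal = y}

lemma discounted_eq_exp_mul {τ : RightContinuousPath E → ℝ≥0∞} {w : RightContinuousPath E}
    {s : ℝ≥0} (h : σ w = s + τ (shift s w)) :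
    discounted q σ F w = Complex.exp (-(q * ((s : ℝ) : ℂ))) * discounted q τ F (shift s w) := by
  unfold discounted
  rcases eq_or_ne (τ (shift s w)) ∞ with htop | hfin
  · simp [h, htop]
  · lift τ (shift s w) to ℝ≥0 using hfin with t
    rw [← ENNReal.coe_add] at h
    simp only [h, ENNReal.coe_lt_top, if_true, ENNReal.toNNReal_coe, ENNReal.coe_toReal,
      shift_shift, NNReal.coe_add, Complex.ofReal_add]
    rw [mul_add, neg_add, Complex.exp_add, mul_assoc]

lemma norm_exp_neg_mul_le_one (hq : 0 ≤ q.re) (c : ℝ≥0∞) :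
    ‖Complex.exp (-(q * (c.toReal : ℂ)))‖ ≤ 1 := by
  rw [Complex.norm_exp, Real.exp_le_one_iff]
  simpa using mul_nonneg hq c.toReal_nonneg

lemma norm_discounted_le (hq : 0 ≤ q.re) {B : ℝ} (hF : ∀ v, ‖F v‖ ≤ B)
    (w : RightContinuousPath E) : ‖discounted q σ F w‖ ≤ B := by
  unfold discounted
  split_ifs
  · rw [norm_mul]
    exact (mul_le_of_le_one_left (norm_nonneg _) (norm_exp_neg_mul_le_one hq _)).trans (hF _)
  · simpa using (norm_nonneg _).trans (hF w)

variable [MeasurableSpace E] [DiscreteTopology E] [DiscreteMeasurableSpace E]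

lemma measurableSet_stoppedAt (hσ : Measurable σ) (y : E) : MeasurableSet (stoppedAt σ y) :=
  (measurableSet_lt hσ measurable_const).inter
    (measurable_apply hσ.ennreal_toNNReal (.of_discrete (s := {y})))

lemma measurable_discounted (hσ : Measurable σ) (hF : Measurable F) :
    Measurable (discounted q σ F) :=
  Measurable.ite (measurableSet_lt hσ measurable_const)
    ((by fun_prop : Measurable fun w => Complex.exp (-(q * ((σ w).toReal : ℂ)))).mul
      (hF.comp (measurable_shift hσ.ennreal_toNNReal)))
    measurable_const

lemma integrable_discounted {μ : Measure (RightContinuousPath E)} [IsFiniteMeasure μ]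
    (hq : 0 ≤ q.re) (hσ : Measurable σ) (hF : Measurable F) {B : ℝ} (hB : ∀ v, ‖F v‖ ≤ B) :
    Integrable (discounted q σ F) μ :=
  .of_bound (measurable_discounted hσ hF).aestronglyMeasurable B
    (.of_forall (norm_discounted_le hq hB))

variable [Countable E] {Q : E → Measure (RightContinuousPath E)}

lemma IsMarkovFamily.map_prodMk_shift (hQ : IsMarkovFamily Q) (hσ : IsOptionalTime σ) (x y : E) :
    ((Q x).restrict (stoppedAt σ y)).map (fun w => (σ w, shift (σ w).toNNReal w)) =
      (((Q x).restrict (stoppedAt σ y)).map σ).prod (Q y) := by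
  have := hQ.isProbabilityMeasure
  have hshift := measurable_shift hσ.measurable.ennreal_toNNReal
  refine (Measure.prod_eq fun I C hI hC => ?_).symm
  have hset : σ ⁻¹' I ∩ stoppedAt σ y = {w | σ w ∈ I \ {∞} ∧ w.1 (σ w).toNNReal = y} := by
    ext w
    simp [stoppedAt, lt_top_iff_ne_top, and_assoc]
  have hmap : (fun w => (σ w, shift (σ w).toNNReal w)) ⁻¹' I ×ˢ C ∩ stoppedAt σ y =
      {w | σ w ∈ I \ {∞} ∧ w.1 (σ w).toNNReal = y} ∩
        (fun w => shift (σ w).toNNReal w) ⁻¹' C := by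
    rw [← hset, Set.mk_preimage_prod, Set.inter_right_comm]
  rw [Measure.map_apply (hσ.measurable.prodMk hshift) (hI.prod hC),
    Measure.restrict_apply ((hσ.measurable.prodMk hshift) (hI.prod hC)),
    Measure.map_apply hσ.measurable hI, Measure.restrict_apply (hσ.measurable hI), hset, hmap,
    hQ.strong_markov hσ x y (hI.diff (measurableSet_singleton _)) (by simp) hC]

lemma IsMarkovFamily.setIntegral_discounted (hQ : IsMarkovFamily Q) (hσ : IsOptionalTime σ)
    (hF : Measurable F) (x y : E) :
    ∫ w in stoppedAt σ y, discounted q σ F w ∂Q x =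
      (∫ w in stoppedAt σ y, Complex.exp (-(q * ((σ w).toReal : ℂ))) ∂Q x) * ∫ v, F v ∂Q y := by
  have := hQ.isProbabilityMeasure
  have hexp : Measurable fun c : ℝ≥0∞ => Complex.exp (-(q * (c.toReal : ℂ))) := by fun_prop
  have hprod : Measurable fun p : ℝ≥0∞ × RightContinuousPath E =>
      Complex.exp (-(q * (p.1.toReal : ℂ))) * F p.2 :=
    (hexp.comp measurable_fst).mul (hF.comp measurable_snd)
  calc
    _ = ∫ w in stoppedAt σ y,
          Complex.exp (-(q * ((σ w).toReal : ℂ))) * F (shift (σ w).toNNReal w) ∂Q x :=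
      setIntegral_congr_fun (measurableSet_stoppedAt hσ.measurable y) fun w hw => if_pos hw.1
    _ = ∫ p, Complex.exp (-(q * (p.1.toReal : ℂ))) * F p.2
          ∂(((Q x).restrict (stoppedAt σ y)).map σ).prod (Q y) := by
      rw [← hQ.map_prodMk_shift hσ, integral_map
        (hσ.measurable.prodMk (measurable_shift hσ.measurable.ennreal_toNNReal)).aemeasurable
        hprod.aestronglyMeasurable]
    _ = _ := by
      rw [integral_prod_mul (fun c : ℝ≥0∞ => Complex.exp (-(q * (c.toReal : ℂ)))) F,
        integral_map hσ.measurable.aemeasurable hexp.aestronglyMeasurable]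

lemma IsMarkovFamily.integral_discounted_eq_tsum (hQ : IsMarkovFamily Q) (hσ : IsOptionalTime σ)
    (hq : 0 ≤ q.re) (hF : Measurable F) {B : ℝ} (hB : ∀ v, ‖F v‖ ≤ B) (x : E) :
    ∫ w, discounted q σ F w ∂Q x =
      ∑' y, (∫ w in stoppedAt σ y, Complex.exp (-(q * ((σ w).toReal : ℂ))) ∂Q x) *
        ∫ v, F v ∂Q y := by
  have := hQ.isProbabilityMeasure
  have hzero : ∀ w ∉ ⋃ y, stoppedAt σ y, discounted q σ F w = 0 := by
    intro w hw
    refine if_neg fun hfin => hw ?_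
    exact Set.mem_iUnion.2 ⟨_, hfin, rfl⟩
  have hdisj : Pairwise (Function.onFun Disjoint (stoppedAt σ)) := fun y z hyz =>
    Set.disjoint_left.2 fun w hy hz => hyz (hy.2.symm.trans hz.2)
  rw [← setIntegral_eq_integral_of_forall_compl_eq_zero hzero, integral_iUnion
    (measurableSet_stoppedAt hσ.measurable) hdisj
    (integrable_discounted hq hσ.measurable hF hB).integrableOn]
  exact tsum_congr fun y => hQ.setIntegral_discounted hσ hF x y

theorem IsMarkovFamily.integral_discounted (hQ : IsMarkovFamily Q) (hσ : IsOptionalTime σ)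
    (hq : 0 ≤ q.re) (hF : Measurable F) {B : ℝ} (hB : ∀ v, ‖F v‖ ≤ B) (x : E) :
    ∫ w, discounted q σ F w ∂Q x =
      ∫ w, discounted q σ (fun v => ∫ u, F u ∂Q (v.1 0)) w ∂Q x := by
  have := hQ.isProbabilityMeasure
  have hmeas : Measurable fun v : RightContinuousPath E => ∫ u, F u ∂Q (v.1 0) :=
    (Measurable.of_discrete (f := fun y => ∫ u, F u ∂Q y)).comp (measurable_coord 0)
  have hbound : ∀ v : RightContinuousPath E, ‖∫ u, F u ∂Q (v.1 0)‖ ≤ B := fun v => by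
    simpa using norm_integral_le_of_norm_le_const (μ := Q (v.1 0)) (.of_forall hB)
  rw [hQ.integral_discounted_eq_tsum hσ hq hF hB,
    hQ.integral_discounted_eq_tsum hσ hq hmeas hbound]
  refine tsum_congr fun y => ?_
  have hstart : ∫ v, ∫ u, F u ∂Q (v.1 0) ∂Q y = ∫ _, ∫ u, F u ∂Q y ∂Q y :=
    integral_congr_ae ((hQ.ae_start y).mono fun v hv => by simp only [hv])
  rw [hstart, integral_const, probReal_univ, one_smul]

end Discounted

/-! ### Exit and drawdown times of a path -/

section ExitTime

variable {A : Set E} {w : RightContinuousPath E}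

/-- The time `inf {t > 0 : w t ∉ A}`, with `inf ∅ = ∞`. -/
noncomputable def exitTime (A : Set E) (w : RightContinuousPath E) : ℝ≥0∞ :=
  sInf {T : ℝ≥0∞ | ∃ t : ℝ≥0, T = t ∧ 0 < t ∧ w.1 t ∉ A}

lemma exitTime_lt_iff {c : ℝ≥0∞} :
    exitTime A w < c ↔ ∃ t : ℝ≥0, 0 < t ∧ (t : ℝ≥0∞) < c ∧ w.1 t ∉ A := by
  rw [exitTime, sInf_lt_iff]
  constructor
  · rintro ⟨_, ⟨t, rfl, ht, hA⟩, hc⟩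
    exact ⟨t, ht, hc, hA⟩
  · rintro ⟨t, ht, hc, hA⟩
    exact ⟨t, ⟨t, rfl, ht, hA⟩, hc⟩

lemma exitTime_le {t : ℝ≥0} (ht : 0 < t) (hA : w.1 t ∉ A) : exitTime A w ≤ t :=
  sInf_le ⟨t, rfl, ht, hA⟩

lemma mem_of_lt_exitTime (h0 : w.1 0 ∈ A) {t : ℝ≥0} (ht : t < exitTime A w) : w.1 t ∈ A := by
  rcases eq_zero_or_pos t with rfl | hpos
  · exact h0
  · exact not_not.1 fun hA => (exitTime_le hpos hA).not_gt ht

variable [DiscreteTopology E]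

lemma notMem_of_exitTime_eq {T : ℝ≥0} (hT : exitTime A w = T) : w.1 T ∉ A := by
  intro hmem
  obtain ⟨d, hTd, hd⟩ := mem_nhdsGE_iff_exists_Ico_subset.1 (w.eventually_eq T)
  obtain ⟨t, ht, htd, hA⟩ := (exitTime_lt_iff (c := d)).1 (hT ▸ ENNReal.coe_lt_coe.2 hTd)
  have hTt : T ≤ t := ENNReal.coe_le_coe.1 (hT ▸ exitTime_le ht hA)
  exact hA ((hd ⟨hTt, ENNReal.coe_lt_coe.1 htd⟩ : w.1 t = w.1 T) ▸ hmem)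

variable [MeasurableSpace E] [DiscreteMeasurableSpace E] [Countable E]

lemma isOptionalTime_exitTime (A : Set E) : IsOptionalTime (exitTime A) := by
  intro c
  let d := TopologicalSpace.denseSeq ℝ≥0
  have hset : {w | exitTime A w < c} = ⋃ (i) (_ : 0 < d i ∧ d i < c), {w | w.1 (d i) ∉ A} := by
    ext w
    simp only [Set.mem_ofPred_eq, Set.mem_iUnion, exists_prop, exitTime_lt_iff,
      ENNReal.coe_lt_coe]
    constructor
    · rintro ⟨t, ht, htc, hA⟩
      obtain ⟨i, hti, hic, hi⟩ := w.exists_denseSeq_apply_eq (ENNReal.coe_lt_coe.2 htc)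
      exact ⟨i, ⟨ht.trans hti, ENNReal.coe_lt_coe.1 hic⟩, hi ▸ hA⟩
    · rintro ⟨i, ⟨hpos, hic⟩, hA⟩
      exact ⟨d i, hpos, hic, hA⟩
  rw [hset]
  refine .iUnion fun i => .iUnion fun hi => ?_
  exact measurable_coord_coordFiltration hi.2.le (.of_discrete (s := Aᶜ))

end ExitTime

section DrawdownTime

variable {S : Finset ℝ} {a : ℝ} {w : RightContinuousPath S} {n : ℕ}

/-- The drawdown times without recovery of a path. As `S` is finite, suprema over time windows are
attained, so that `τ_{n+1}` can be encoded as the first `t` admitting some `u ∈ [τ_n, t]` with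
`a ≤ w u - w t`. -/
noncomputable def drawdownTime (a : ℝ) : ℕ → RightContinuousPath S → ℝ≥0∞
  | 0, _ => 0
  | n + 1, w => sInf {T : ℝ≥0∞ | ∃ u t : ℝ≥0, T = t ∧ drawdownTime a n w ≤ u ∧ u ≤ t ∧
      a ≤ (w.1 u : ℝ) - w.1 t}

lemma drawdownTime_succ_le {u t : ℝ≥0} (hu : drawdownTime a n w ≤ u) (hut : u ≤ t)
    (h : a ≤ (w.1 u : ℝ) - w.1 t) : drawdownTime a (n + 1) w ≤ t :=
  sInf_le ⟨u, t, rfl, hu, hut, h⟩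

lemma le_drawdownTime_succ_iff {c : ℝ≥0∞} :
    c ≤ drawdownTime a (n + 1) w ↔ ∀ u t : ℝ≥0, drawdownTime a n w ≤ u → u ≤ t →
      a ≤ (w.1 u : ℝ) - w.1 t → c ≤ t := by
  rw [drawdownTime, le_sInf_iff]
  constructor
  · exact fun h u t hu hut hd => h t ⟨u, t, rfl, hu, hut, hd⟩
  · rintro h _ ⟨u, t, rfl, hu, hut, hd⟩
    exact h u t hu hut hd

lemma measurable_drawdownTime (ha : 0 < a) (n : ℕ) :
    Measurable (drawdownTime a n : RightContinuousPath S → ℝ≥0∞) := by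
  induction n with
  | zero => exact measurable_const
  | succ n ih =>
    let d := TopologicalSpace.denseSeq ℝ≥0
    refine measurable_of_Iio fun c => ?_
    have hset : drawdownTime a (n + 1) ⁻¹' Set.Iio c =
        ⋃ (i) (j) (_ : d i ≤ d j ∧ (d j : ℝ≥0∞) < c),
          {w : RightContinuousPath S | drawdownTime a n w < d i} ∩
            {w | a ≤ (w.1 (d i) : ℝ) - w.1 (d j)} := by
      ext w
      simp only [Set.mem_preimage, Set.mem_Iio, Set.mem_iUnion, exists_prop, Set.mem_inter_iff,
        Set.mem_ofPred_eq]
      constructor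
      · intro h
        rw [← not_le, le_drawdownTime_succ_iff] at h
        push Not at h
        obtain ⟨u, t, hu, hut, hd, htc⟩ := h
        have hne : u ≠ t := by
          rintro rfl
          exact ha.not_ge (by simpa using hd)
        obtain ⟨i, hui, hit, hi⟩ :=
          w.exists_denseSeq_apply_eq (ENNReal.coe_lt_coe.2 (hut.lt_of_ne hne))
        obtain ⟨j, htj, hjc, hj⟩ := w.exists_denseSeq_apply_eq htc
        exact ⟨i, j, ⟨((ENNReal.coe_lt_coe.1 hit).trans htj).le, hjc⟩,
          hu.trans_lt (ENNReal.coe_lt_coe.2 hui), by rwa [hi, hj]⟩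
      · rintro ⟨i, j, ⟨hij, hjc⟩, hi, hd⟩
        exact (drawdownTime_succ_le hi.le hij hd).trans_lt hjc
    rw [hset]
    refine .iUnion fun i => .iUnion fun j => .iUnion fun _ => ?_
    exact (measurableSet_lt ih measurable_const).inter (measurableSet_le measurable_const
      ((measurable_coord (d i)).subtype_val.sub (measurable_coord (d j)).subtype_val))

lemma drawdownTime_succ_le_add {s : ℝ≥0} {m k : ℕ}
    (h : drawdownTime a m w ≤ s + drawdownTime a k (shift s w)) :
    drawdownTime a (m + 1) w ≤ s + drawdownTime a (k + 1) (shift s w) := by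
  rw [drawdownTime, drawdownTime, ENNReal.add_sInf]
  refine le_iInf₂ ?_
  rintro _ ⟨u, t, rfl, hu, hut, hd⟩
  rw [← ENNReal.coe_add]
  refine drawdownTime_succ_le (u := s + u) (h.trans ?_) (by gcongr) hd
  rw [ENNReal.coe_add]
  gcongr

lemma drawdownTime_add_eq_add {s : ℝ≥0} {m k : ℕ}
    (h : drawdownTime a m w = s + drawdownTime a k (shift s w)) (i : ℕ) :
    drawdownTime a (m + i) w = s + drawdownTime a (k + i) (shift s w) := by
  induction i with
  | zero => exact h
  | succ i ih =>
    rw [← add_assoc, ← add_assoc]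
    refine le_antisymm ?_ (le_drawdownTime_succ_iff.2 fun u t hu hut hd => ?_)
    · exact drawdownTime_succ_le_add ih.le
    · have hsu : s ≤ u := ENNReal.coe_le_coe.1 (le_self_add.trans (ih ▸ hu))
      obtain ⟨u, rfl⟩ := exists_add_of_le hsu
      obtain ⟨t, rfl⟩ := exists_add_of_le (hsu.trans hut)
      rw [ih, ENNReal.coe_add, ENNReal.add_le_add_iff_left ENNReal.coe_ne_top] at hu
      rw [ENNReal.coe_add]
      gcongr
      exact drawdownTime_succ_le hu ((add_le_add_iff_left s).1 hut) hd

lemma drawdownTime_succ_of_isMax {s : ℝ≥0} (hs : s ≤ drawdownTime a 1 w)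
    (hmax : ∀ u ≤ s, w.1 u ≤ w.1 s) (n : ℕ) :
    drawdownTime a (n + 1) w = s + drawdownTime a (n + 1) (shift s w) := by
  have hone : drawdownTime a 1 w = s + drawdownTime a 1 (shift s w) := by
    refine le_antisymm ?_ (le_drawdownTime_succ_iff.2 fun u t hu hut hd => ?_)
    · exact drawdownTime_succ_le_add zero_le
    · have hst : s ≤ t := ENNReal.coe_le_coe.1 (hs.trans (drawdownTime_succ_le hu hut hd))
      obtain ⟨t, rfl⟩ := exists_add_of_le hst
      obtain ⟨v, hvt, hv⟩ : ∃ v ≤ t, w.1 u ≤ w.1 (s + v) := by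
        rcases le_total u s with hus | hsu
        · exact ⟨0, zero_le, by simpa using hmax u hus⟩
        · obtain ⟨v, rfl⟩ := exists_add_of_le hsu
          exact ⟨v, (add_le_add_iff_left s).1 hut, le_rfl⟩
      rw [ENNReal.coe_add]
      gcongr
      exact drawdownTime_succ_le (u := v) zero_le hvt
        (hd.trans (sub_le_sub_right (Subtype.coe_le_coe.2 hv) _))
  simpa only [add_comm n] using drawdownTime_add_eq_add hone n

/-- The states in `(x - a, x]`, in which a path started at `x` has neither a drawdown of size `a`
nor a new maximum. -/
def drawdownWindow (a : ℝ) (x : S) : Set S := Subtype.val ⁻¹' Set.Ioc ((x : ℝ) - a) x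

lemma exitTime_drawdownWindow_le (ha : 0 < a) (n : ℕ) :
    exitTime (drawdownWindow a (w.1 0)) w ≤ drawdownTime a (n + 1) w := by
  refine le_drawdownTime_succ_iff.2 fun u t _ hut hd => not_lt.1 fun ht => ?_
  have h0 : w.1 0 ∈ drawdownWindow a (w.1 0) := ⟨sub_lt_self _ ha, le_rfl⟩
  have hmemt := mem_of_lt_exitTime h0 ht
  have hmemu := mem_of_lt_exitTime h0 ((ENNReal.coe_le_coe.2 hut).trans_lt ht)
  linarith [hmemt.1, hmemu.2]

lemma drawdownTime_succ_of_exit_below (ha : 0 < a) {T : ℝ≥0}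
    (hT : exitTime (drawdownWindow a (w.1 0)) w = T) (hbelow : (w.1 T : ℝ) ≤ w.1 0 - a) (n : ℕ) :
    drawdownTime a (n + 1) w = T + drawdownTime a n (shift T w) := by
  have hone : drawdownTime a 1 w = T + drawdownTime a 0 (shift T w) := by
    rw [drawdownTime, add_zero]
    exact le_antisymm (drawdownTime_succ_le (u := 0) zero_le zero_le (by linarith))
      (hT ▸ exitTime_drawdownWindow_le ha 0)
  simpa only [add_comm n, zero_add] using drawdownTime_add_eq_add hone n

lemma drawdownTime_succ_of_exit_above (ha : 0 < a) {T : ℝ≥0}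
    (hT : exitTime (drawdownWindow a (w.1 0)) w = T) (habove : w.1 0 < w.1 T) (n : ℕ) :
    drawdownTime a (n + 1) w = T + drawdownTime a (n + 1) (shift T w) := by
  refine drawdownTime_succ_of_isMax (hT ▸ exitTime_drawdownWindow_le ha 0) (fun u hu => ?_) n
  rcases hu.lt_or_eq with hlt | rfl
  · have h0 : w.1 0 ∈ drawdownWindow a (w.1 0) := ⟨sub_lt_self _ ha, le_rfl⟩
    exact (mem_of_lt_exitTime h0 (hT ▸ ENNReal.coe_lt_coe.2 hlt)).2.trans habove.le
  · exact le_rfl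

lemma discounted_drawdownTime_succ (ha : 0 < a) (q : ℂ) (F : RightContinuousPath S → ℂ) (n : ℕ) :
    discounted q (drawdownTime a (n + 1)) F w =
      discounted q (exitTime (drawdownWindow a (w.1 0)))
        (fun v => discounted q (drawdownTime a (if (v.1 0 : ℝ) ≤ w.1 0 - a then n else n + 1)) F v)
        w := by
  rcases eq_or_ne (exitTime (drawdownWindow a (w.1 0)) w) ∞ with htop | hfin
  · have hτ : drawdownTime a (n + 1) w = ∞ :=
      top_le_iff.1 (htop ▸ exitTime_drawdownWindow_le ha n)
    simp [discounted, htop, hτ]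
  · obtain ⟨T, hT⟩ : ∃ T : ℝ≥0, T = exitTime (drawdownWindow a (w.1 0)) w :=
      ⟨_, ENNReal.coe_toNNReal hfin⟩
    have hτ : drawdownTime a (n + 1) w =
        T + drawdownTime a (if (w.1 T : ℝ) ≤ w.1 0 - a then n else n + 1) (shift T w) := by
      split_ifs with hbelow
      · exact drawdownTime_succ_of_exit_below ha hT.symm hbelow n
      · refine drawdownTime_succ_of_exit_above ha hT.symm ?_ n
        by_contra! hle
        exact notMem_of_exitTime_eq hT.symm ⟨not_le.1 hbelow, hle⟩
    rw [discounted_eq_exp_mul hτ]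
    simp [discounted, ← hT]

theorem IsMarkovFamily.integral_discounted_drawdownTime_succ
    {Q : S → Measure (RightContinuousPath S)} (hQ : IsMarkovFamily Q) (ha : 0 < a) {q : ℂ}
    (hq : 0 ≤ q.re) {F : RightContinuousPath S → ℂ} (hF : Measurable F) {B : ℝ}
    (hB : ∀ v, ‖F v‖ ≤ B) (n : ℕ) (x : S) :
    ∫ w, discounted q (drawdownTime a (n + 1)) F w ∂Q x =
      ∫ w, discounted q (exitTime (drawdownWindow a x)) (fun v =>
        ∫ u, discounted q (drawdownTime a (if (v.1 0 : ℝ) ≤ x - a then n else n + 1)) F u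
          ∂Q (v.1 0)) w ∂Q x := by
  let restarted : RightContinuousPath S → ℂ := fun v =>
    discounted q (drawdownTime a (if (v.1 0 : ℝ) ≤ x - a then n else n + 1)) F v
  have hmeas : Measurable restarted :=
    (measurable_from_prod_countable_right
      (f := fun p : ℕ × RightContinuousPath S => discounted q (drawdownTime a p.1) F p.2)
      fun k => measurable_discounted (measurable_drawdownTime ha k) hF).comp
      (((Measurable.of_discrete (f := fun y : S => if (y : ℝ) ≤ x - a then n else n + 1)).comp
        (measurable_coord 0)).prodMk measurable_id)
  have hbound : ∀ v, ‖restarted v‖ ≤ B := norm_discounted_le hq hB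
  have hinner : ∀ y, ∫ u, restarted u ∂Q y =
      ∫ u, discounted q (drawdownTime a (if (y : ℝ) ≤ x - a then n else n + 1)) F u ∂Q y :=
    fun y => integral_congr_ae ((hQ.ae_start y).mono fun u hu => by simp only [restarted, hu])
  calc
    _ = ∫ w, discounted q (exitTime (drawdownWindow a x)) restarted w ∂Q x :=
      integral_congr_ae ((hQ.ae_start x).mono fun w hw => by
        simpa only [hw] using discounted_drawdownTime_succ (w := w) ha q F n)
    _ = _ := by
      rw [hQ.integral_discounted (isOptionalTime_exitTime _) hq hmeas hbound]
      simp only [hinner]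

end DrawdownTime

end RightContinuousPath

/-! ### The law of the Markov chain on path space -/

namespace MarkovChain

open RightContinuousPath

variable {S : Finset ℝ} {G : Matrix S S ℝ} {Ω : Type*} [MeasurableSpace Ω]

section PathLaw

/-- The trajectory `t ↦ Y_t ω`. -/
def path (M : MarkovChain G Ω) (ω : Ω) : RightContinuousPath S :=
  ⟨fun t => M.Y t ω, M.rightContinuous ω⟩

lemma measurable_path (M : MarkovChain G Ω) : Measurable M.path :=
  (measurable_pi_lambda _ M.measurable_Y).subtype_mk

/-- The law on path space of the chain started at `x`. -/
noncomputable def pathLaw (M : MarkovChain G Ω) (x : S) : Measure (RightContinuousPath S) :=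
  (M.P x).map M.path

instance (M : MarkovChain G Ω) (x : S) : IsProbabilityMeasure (M.pathLaw x) :=
  have := M.isProbabilityMeasure x
  Measure.isProbabilityMeasure_map M.measurable_path.aemeasurable

lemma pathLaw_real_cylinder (M : MarkovChain G Ω) {t : ℕ → ℝ≥0} (ht : Monotone t) (ht0 : t 0 = 0)
    (z : ℕ → S) (m : ℕ) :
    (M.pathLaw (z 0)).real {w | ∀ i ≤ m, w.1 (t i) = z i} =
      ∏ i ∈ Finset.range m,
        (NormedSpace.exp (((t (i + 1) : ℝ) - t i) • G) : Matrix S S ℝ) (z i) (z (i + 1)) := by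
  rw [pathLaw, map_measureReal_apply M.measurable_path]
  · exact M.finiteDimensional (z 0) m t z ht ht0 rfl
  · have hset : {w : RightContinuousPath S | ∀ i ≤ m, w.1 (t i) = z i} =
        ⋂ (i) (_ : i ≤ m), {w | w.1 (t i) = z i} := by
      ext w
      simp
    rw [hset]
    exact .iInter fun i => .iInter fun _ => measurableSet_apply_eq (t i) (z i)

lemma ae_pathLaw_zero (M : MarkovChain G Ω) (x : S) : ∀ᵐ w ∂M.pathLaw x, w.1 0 = x := by
  refine (mem_ae_iff_prob_eq_one (measurableSet_apply_eq 0 x)).2 ?_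
  rw [← ENNReal.toReal_eq_one_iff, ← measureReal_def]
  simpa using M.pathLaw_real_cylinder (monotone_const (c := 0)) rfl (fun _ => x) 0

lemma pathLaw_real_cylinder_inter (M : MarkovChain G Ω) {t s : ℕ → ℝ≥0} (ht : Monotone t)
    (ht0 : t 0 = 0) (hs : Monotone s) (hs0 : s 0 = 0) {z v : ℕ → S} {m : ℕ} (hv : v 0 = z m)
    (l : ℕ) :
    (M.pathLaw (z 0)).real ({w | ∀ i ≤ m, w.1 (t i) = z i} ∩
        shift (t m) ⁻¹' {w | ∀ j ≤ l, w.1 (s j) = v j}) =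
      (M.pathLaw (z 0)).real {w | ∀ i ≤ m, w.1 (t i) = z i} *
        (M.pathLaw (z m)).real {w | ∀ j ≤ l, w.1 (s j) = v j} := by
  have hjoin : t m + s 0 = t m := by rw [hs0, add_zero]
  let T := splice m t fun j => t m + s j
  let Z := splice m z v
  have hT : Monotone T := monotone_splice ht (hs.const_add (t m)) hjoin
  have hTt : ∀ i ≤ m, T i = t i := fun i => splice_of_le hjoin
  have hZz : ∀ i ≤ m, Z i = z i := fun i => splice_of_le hv
  have hTs : ∀ j, T (m + j) = t m + s j := splice_add m t _
  have hZv : ∀ j, Z (m + j) = v j := splice_add m z v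
  have hset : {w : RightContinuousPath S | ∀ i ≤ m, w.1 (t i) = z i} ∩
      shift (t m) ⁻¹' {w | ∀ j ≤ l, w.1 (s j) = v j} = {w | ∀ i ≤ m + l, w.1 (T i) = Z i} := by
    ext w
    simp only [Set.mem_inter_iff, Set.mem_preimage, Set.mem_ofPred_eq, shift_apply,
      forall_le_add_iff, hTs, hZv]
    exact and_congr_left' (forall₂_congr fun i hi => by rw [hTt i hi, hZz i hi])
  rw [hset, M.pathLaw_real_cylinder ht ht0, ← hv, M.pathLaw_real_cylinder hs hs0,
    ← hZz 0 m.zero_le, M.pathLaw_real_cylinder hT ((hTt 0 m.zero_le).trans ht0),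
    Finset.prod_range_add]
  congr 1
  · refine Finset.prod_congr rfl fun i hi => ?_
    have him := Finset.mem_range.1 hi
    rw [hTt i him.le, hTt (i + 1) him, hZz i him.le, hZz (i + 1) him]
  · refine Finset.prod_congr rfl fun j _ => ?_
    rw [add_assoc, hTs, hTs, hZv, hZv, NNReal.coe_add, NNReal.coe_add, add_sub_add_left_eq_sub]

lemma pathLaw_cylinder_inter (M : MarkovChain G Ω) {J K : Finset ℝ≥0} {t : ℝ≥0} (hJ : 0 ∈ J)
    (ht : IsGreatest (J : Set ℝ≥0) t) (hK : 0 ∈ K) {u v : ℝ≥0 → S} (huv : v 0 = u t) :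
    M.pathLaw (u 0) ({w | ∀ s ∈ J, w.1 s = u s} ∩ shift t ⁻¹' {w | ∀ s ∈ K, w.1 s = v s}) =
      M.pathLaw (u 0) {w | ∀ s ∈ J, w.1 s = u s} * M.pathLaw (u t) {w | ∀ s ∈ K, w.1 s = v s} := by
  obtain ⟨m, r, hr, hr0, rfl, hrJ⟩ := exists_monotone_enumeration ⟨hJ, fun _ _ => zero_le⟩ ht
  obtain ⟨l, s, hs, hs0, -, hsK⟩ :=
    exists_monotone_enumeration ⟨hK, fun _ _ => zero_le⟩ (K.isGreatest_max' ⟨0, hK⟩)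
  have hreal := M.pathLaw_real_cylinder_inter hr hr0 hs hs0 (z := fun i => u (r i))
    (v := fun j => v (s j)) (m := m) (by simpa only [hs0] using huv) l
  simp only [hrJ, hsK, forall_exists_index, and_imp, forall_apply_eq_imp_iff₂]
  simp only [hr0] at hreal
  rwa [measureReal_def, measureReal_def, measureReal_def, ← ENNReal.toReal_mul,
    ENNReal.toReal_eq_toReal_iff' (measure_ne_top _ _)
      (ENNReal.mul_ne_top (measure_ne_top _ _) (measure_ne_top _ _))] at hreal

lemma pathLaw_markov_of_cylinder (M : MarkovChain G Ω) {J : Finset ℝ≥0} {t : ℝ≥0}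
    (hJ : ∀ s ∈ J, s ≤ t) (K : Finset ℝ≥0) {u v : ℝ≥0 → S} (huv : v 0 = u t) :
    M.pathLaw (u 0) ({w | ∀ s ∈ J, w.1 s = u s} ∩ {w | w.1 t = u t} ∩
        shift t ⁻¹' {w | ∀ s ∈ K, w.1 s = v s}) =
      M.pathLaw (u 0) ({w | ∀ s ∈ J, w.1 s = u s} ∩ {w | w.1 t = u t}) *
        M.pathLaw (u t) {w | ∀ s ∈ K, w.1 s = v s} := by
  classical
  have hpast : ({w | ∀ s ∈ J, w.1 s = u s} ∩ {w | w.1 t = u t} : Set _) =ᵐ[M.pathLaw (u 0)]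
      {w | ∀ s ∈ insert 0 (insert t J), w.1 s = u s} := by
    refine Filter.eventuallyEq_set.2 ((M.ae_pathLaw_zero (u 0)).mono fun w hw => ?_)
    simp [hw, and_comm]
  have hfuture : {w | ∀ s ∈ K, w.1 s = v s} =ᵐ[M.pathLaw (u t)]
      {w | ∀ s ∈ insert 0 K, w.1 s = v s} := by
    refine Filter.eventuallyEq_set.2 ((M.ae_pathLaw_zero (u t)).mono fun w hw => ?_)
    simp [hw, huv]
  have hboth : ({w | ∀ s ∈ J, w.1 s = u s} ∩ {w | w.1 t = u t} ∩
      shift t ⁻¹' {w | ∀ s ∈ K, w.1 s = v s} : Set _) =ᵐ[M.pathLaw (u 0)]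
      ({w | ∀ s ∈ insert 0 (insert t J), w.1 s = u s} ∩
        shift t ⁻¹' {w | ∀ s ∈ insert 0 K, w.1 s = v s} : Set _) := by
    refine Filter.eventuallyEq_set.2 ((M.ae_pathLaw_zero (u 0)).mono fun w hw => ?_)
    simp only [Set.mem_inter_iff, Set.mem_preimage, Set.mem_ofPred_eq, Finset.forall_mem_insert,
      shift_apply, add_zero, hw, huv, true_and]
    tauto
  have hgreatest : IsGreatest (↑(insert 0 (insert t J)) : Set ℝ≥0) t :=
    ⟨by simp, by simpa [upperBounds] using hJ⟩
  rw [measure_congr hpast, measure_congr hfuture, measure_congr hboth,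
    M.pathLaw_cylinder_inter (by simp) hgreatest (by simp) huv]

lemma isMarkovFamily_pathLaw (M : MarkovChain G Ω) : IsMarkovFamily M.pathLaw := by
  refine isMarkovFamily_of_finiteCylinders (fun x => inferInstance) M.ae_pathLaw_zero ?_
  rintro x y t _ ⟨J, u, hJ, rfl⟩ _ ⟨K, v, -, rfl⟩
  by_cases hpast : ∃ w₀ : RightContinuousPath S, w₀.1 0 = x ∧ w₀.1 t = y ∧ ∀ s ∈ J, w₀.1 s = u s
  swap
  · have hnull : M.pathLaw x ({w | ∀ s ∈ J, w.1 s = u s} ∩ {w | w.1 t = y}) = 0 :=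
      measure_mono_null (fun w hw hw0 => hpast ⟨w, hw0, hw.2, hw.1⟩) (M.ae_pathLaw_zero x)
    rw [measure_inter_null_of_null_left _ hnull, hnull, zero_mul]
  by_cases hfuture : ∃ v₀ : RightContinuousPath S, v₀.1 0 = y ∧ ∀ s ∈ K, v₀.1 s = v s
  swap
  · have hnull : M.pathLaw y {w | ∀ s ∈ K, w.1 s = v s} = 0 :=
      measure_mono_null (fun w hw hw0 => hfuture ⟨w, hw0, hw⟩) (M.ae_pathLaw_zero y)
    rw [hnull, mul_zero]
    refine measure_mono_null (fun w hw => hfuture ⟨shift t w, ?_, hw.2⟩) measure_empty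
    simpa using hw.1.2
  obtain ⟨w₀, rfl, rfl, hw₀⟩ := hpast
  obtain ⟨v₀, hv₀, hv⟩ := hfuture
  have hA : {w : RightContinuousPath S | ∀ s ∈ J, w.1 s = u s} = {w | ∀ s ∈ J, w.1 s = w₀.1 s} :=
    Set.ext fun w => forall₂_congr fun s hs => by rw [hw₀ s hs]
  have hC : {w : RightContinuousPath S | ∀ s ∈ K, w.1 s = v s} = {w | ∀ s ∈ K, w.1 s = v₀.1 s} :=
    Set.ext fun w => forall₂_congr fun s hs => by rw [hv s hs]
  rw [hA, hC]
  exact M.pathLaw_markov_of_cylinder hJ K hv₀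

end PathLaw

/-! ### Payoffs and their expectations -/

section Payoffs

variable {a : ℝ} {q : ℂ} {A : Set ℝ}

lemma le_runningMax_sub_iff (M : MarkovChain G Ω) {s t : ℝ≥0} (hst : s ≤ t) (ω : Ω) :
    a ≤ M.runningMax s t ω - (M.Y t ω : ℝ) ↔
      ∃ u, s ≤ u ∧ u ≤ t ∧ a ≤ (M.Y u ω : ℝ) - (M.Y t ω : ℝ) := by
  have hfin : ((fun u => (M.Y u ω : ℝ)) '' Set.Icc s t).Finite :=
    S.finite_toSet.subset (Set.image_subset_iff.2 fun u _ => (M.Y u ω).2)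
  constructor
  · intro h
    obtain ⟨u, hu, hmax⟩ := ((Set.nonempty_Icc.2 hst).image _).csSup_mem hfin
    exact ⟨u, hu.1, hu.2, h.trans_eq (congrArg (· - (M.Y t ω : ℝ)) hmax.symm)⟩
  · rintro ⟨u, hsu, hut, h⟩
    exact h.trans (sub_le_sub_right (le_csSup hfin.bddAbove ⟨u, ⟨hsu, hut⟩, rfl⟩) _)

lemma drawdownTime_eq_drawdownTime_path (M : MarkovChain G Ω) (ha : 0 < a) (n : ℕ) (ω : Ω) :
    M.drawdownTime a n ω = RightContinuousPath.drawdownTime a n (M.path ω) := by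
  induction n with
  | zero => rfl
  | succ n ih =>
    rw [drawdownTime, RightContinuousPath.drawdownTime, ← ih]
    congr 1
    ext T
    constructor
    · rintro ⟨t, rfl, hlt, h⟩
      lift M.drawdownTime a n ω to ℝ≥0 using hlt.ne_top with s
      obtain ⟨u, hsu, hut, hd⟩ := (M.le_runningMax_sub_iff (ENNReal.coe_le_coe.1 hlt.le) ω).1 h
      exact ⟨u, t, rfl, ENNReal.coe_le_coe.2 hsu, hut, hd⟩
    · rintro ⟨u, t, rfl, hsu, hut, hd⟩
      lift M.drawdownTime a n ω to ℝ≥0 using ne_top_of_le_ne_top ENNReal.coe_ne_top hsu with s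
      rw [ENNReal.coe_le_coe] at hsu
      have hne : u ≠ t := by
        rintro rfl
        exact ha.not_ge (by simpa using hd)
      exact ⟨t, rfl, ENNReal.coe_lt_coe.2 (hsu.trans_lt (hut.lt_of_ne hne)),
        (M.le_runningMax_sub_iff (hsu.trans hut) ω).2 ⟨u, hsu, hut, hd⟩⟩

lemma drawdownPayoff_eq_discounted (M : MarkovChain G Ω) (ha : 0 < a) (f : S → ℂ) (n : ℕ) (ω : Ω) :
    M.drawdownPayoff a f n q ω =
      discounted q (RightContinuousPath.drawdownTime a n) (fun v => f (v.1 0)) (M.path ω) := by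
  simp only [drawdownPayoff, M.drawdownTime_eq_drawdownTime_path ha, discounted, shift_apply,
    add_zero]
  rfl

lemma passagePayoff_const_eq_discounted (M : MarkovChain G Ω) (g : S → ℂ) (ω : Ω) :
    M.passagePayoff A (fun _ => q) g ω =
      discounted q (exitTime (Subtype.val ⁻¹' A)) (fun v => g (v.1 0)) (M.path ω) := by
  have hexit : M.passageTime A ω = exitTime (Subtype.val ⁻¹' A) (M.path ω) := rfl
  simp only [passagePayoff, hexit, discounted, shift_apply, add_zero,
    intervalIntegral.integral_const, sub_zero, Complex.real_smul, mul_comm q]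
  rfl

lemma measurable_comp_coord_zero (g : S → ℂ) :
    Measurable fun v : RightContinuousPath S => g (v.1 0) :=
  Measurable.of_discrete.comp (measurable_coord 0)

lemma integrable_discounted_path (M : MarkovChain G Ω) (hq : 0 ≤ q.re)
    {σ : RightContinuousPath S → ℝ≥0∞} (hσ : Measurable σ) (g : S → ℂ) (x : S) :
    Integrable (fun ω => discounted q σ (fun v => g (v.1 0)) (M.path ω)) (M.P x) := by
  obtain ⟨B, hB⟩ := Finite.exists_le fun y => ‖g y‖
  exact (integrable_discounted (μ := M.pathLaw x) hq hσ (measurable_comp_coord_zero g)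
    fun v => hB _).comp_measurable M.measurable_path

lemma integrable_drawdownPayoff (M : MarkovChain G Ω) (ha : 0 < a) (f : S → ℂ) (hq : 0 ≤ q.re)
    (n : ℕ) (x : S) : Integrable (M.drawdownPayoff a f n q) (M.P x) := by
  simpa only [← M.drawdownPayoff_eq_discounted ha] using
    M.integrable_discounted_path hq (measurable_drawdownTime ha n) f x

lemma integrable_passagePayoff (M : MarkovChain G Ω) (hq : 0 ≤ q.re) (A : Set ℝ) (g : S → ℂ)
    (x : S) : Integrable (M.passagePayoff A (fun _ => q) g) (M.P x) := by
  simpa only [← M.passagePayoff_const_eq_discounted] using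
    M.integrable_discounted_path hq (isOptionalTime_exitTime (Subtype.val ⁻¹' A)).measurable g x

end Payoffs

section Expectations

variable {a : ℝ} {q : ℂ} {A : Set ℝ}

lemma drawdownExpectation_eq_integral_pathLaw (M : MarkovChain G Ω) (ha : 0 < a) (f : S → ℂ)
    (n : ℕ) (x : S) :
    M.drawdownExpectation a f n q x =
      ∫ w, discounted q (RightContinuousPath.drawdownTime a n) (fun v => f (v.1 0)) w
        ∂M.pathLaw x := by
  simp only [drawdownExpectation, M.drawdownPayoff_eq_discounted ha]
  exact (integral_map M.measurable_path.aemeasurable (measurable_discounted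
    (measurable_drawdownTime ha n) (measurable_comp_coord_zero f)).aestronglyMeasurable).symm

lemma passageExpectation_const_eq_integral_pathLaw (M : MarkovChain G Ω) (g : S → ℂ) (x : S) :
    M.passageExpectation A (fun _ => q) x g =
      ∫ w, discounted q (exitTime (Subtype.val ⁻¹' A)) (fun v => g (v.1 0)) w ∂M.pathLaw x := by
  simp only [passageExpectation, M.passagePayoff_const_eq_discounted]
  exact (integral_map M.measurable_path.aemeasurable (measurable_discounted
    (isOptionalTime_exitTime _).measurable
    (measurable_comp_coord_zero g)).aestronglyMeasurable).symm

lemma drawdownExpectation_zero (M : MarkovChain G Ω) (f : S → ℂ) (x : S) :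
    M.drawdownExpectation a f 0 q x = f x := by
  have := M.isProbabilityMeasure x
  have hpayoff : M.drawdownPayoff a f 0 q =ᵐ[M.P x] fun _ => f x := by
    filter_upwards [ae_of_ae_map M.measurable_path.aemeasurable (M.ae_pathLaw_zero x)] with ω hω
    have hY : M.Y 0 ω = x := hω
    simp [drawdownPayoff, drawdownTime, hY]
  rw [drawdownExpectation, integral_congr_ae hpayoff, integral_const, probReal_univ, one_smul]

lemma drawdownExpectation_succ_eq_passageExpectation (M : MarkovChain G Ω) (ha : 0 < a)
    (f : S → ℂ) (hq : 0 ≤ q.re) (n : ℕ) (x : S) :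
    M.drawdownExpectation a f (n + 1) q x =
      M.passageExpectation (Set.Ioc ((x : ℝ) - a) x) (fun _ => q) x fun z =>
        M.drawdownExpectation a f (if (z : ℝ) ≤ x - a then n else n + 1) q z := by
  obtain ⟨B, hB⟩ := Finite.exists_le fun y => ‖f y‖
  simp only [M.passageExpectation_const_eq_integral_pathLaw,
    M.drawdownExpectation_eq_integral_pathLaw ha]
  exact M.isMarkovFamily_pathLaw.integral_discounted_drawdownTime_succ ha hq
    (measurable_comp_coord_zero f) (fun v => hB _) n x

lemma passageExpectation_eq_sum (M : MarkovChain G Ω) (hq : 0 ≤ q.re) (A : Set ℝ) (g : S → ℂ)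
    (x : S) :
    M.passageExpectation A (fun _ => q) x g =
      ∑ y, M.passageExpectation A (fun _ => q) x (fun z => if z = y then 1 else 0) * g y := by
  have hpayoff : ∀ ω, M.passagePayoff A (fun _ => q) g ω =
      ∑ y, M.passagePayoff A (fun _ => q) (fun z => if z = y then 1 else 0) ω * g y := fun ω => by
    unfold passagePayoff
    split_ifs <;> simp
  simp only [passageExpectation, hpayoff, ← integral_mul_const]
  exact integral_finsetSum _ fun y _ => (M.integrable_passagePayoff hq A _ x).mul_const _

lemma passageExpectation_indicator_of_mem (M : MarkovChain G Ω) (k : S → ℂ) {y : S} (x : S)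
    (hy : (y : ℝ) ∈ A) :
    M.passageExpectation A k x (fun z => if z = y then 1 else 0) = 0 := by
  have hpayoff : ∀ ω, M.passagePayoff A k (fun z => if z = y then 1 else 0) ω = 0 := fun ω => by
    refine ite_eq_right_iff.2 fun hfin => mul_eq_zero_of_right _ (if_neg ?_)
    rintro rfl
    have hexit : exitTime (Subtype.val ⁻¹' A) (M.path ω) = (M.passageTime A ω).toNNReal :=
      (ENNReal.coe_toNNReal hfin.ne).symm
    exact notMem_of_exitTime_eq hexit hy
  simp only [passageExpectation, hpayoff, integral_zero]

theorem drawdownExpectation_succ (M : MarkovChain G Ω) (ha : 0 < a) (f : S → ℂ) (hq : 0 ≤ q.re)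
    (n : ℕ) (x : S) :
    M.drawdownExpectation a f (n + 1) q x =
      M.passageExpectation (Set.Ioc ((x : ℝ) - a) x) (fun _ => q) x
          (fun z => if (z : ℝ) ≤ x - a then M.drawdownExpectation a f n q z else 0) +
        ∑ y with x < y,
          M.passageExpectation (Set.Ioc ((x : ℝ) - a) x) (fun _ => q) x
            (fun z => if z = y then 1 else 0) * M.drawdownExpectation a f (n + 1) q y := by
  rw [M.drawdownExpectation_succ_eq_passageExpectation ha f hq, M.passageExpectation_eq_sum hq,
    M.passageExpectation_eq_sum hq, Finset.sum_filter, ← Finset.sum_add_distrib]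
  refine Finset.sum_congr rfl fun y _ => ?_
  by_cases hbelow : (y : ℝ) ≤ x - a
  · have hxy : ¬x < y := fun h => by linarith [Subtype.coe_lt_coe.2 h]
    simp [hbelow, hxy]
  by_cases habove : x < y
  · simp [hbelow, habove]
  · have hmem : (y : ℝ) ∈ Set.Ioc ((x : ℝ) - a) x := ⟨not_le.1 hbelow, not_lt.1 habove⟩
    simp [M.passageExpectation_indicator_of_mem (fun _ => q) x hmem, habove]

end Expectations

end MarkovChain

theorem mainTheorem5_general {S : Finset ℝ} (G : Matrix S S ℝ)
    {Ω : Type*} [MeasurableSpace Ω] (M : MarkovChain G Ω)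
    (a : ℝ) (ha : 0 < a) (f : S → ℂ) (q : ℂ) (hq : 0 ≤ q.re) :
    (∀ (n : ℕ) (x : S), Integrable (M.drawdownPayoff a f n q) (M.P x)) ∧
    (∀ (x : S) (g : S → ℂ),
      Integrable (M.passagePayoff (Set.Ioc ((x : ℝ) - a) x) (fun _ => q) g) (M.P x)) ∧
    (∀ x : S, M.drawdownExpectation a f 0 q x = f x) ∧
    (∀ n : ℕ, 1 ≤ n → ∀ x : S,
      M.drawdownExpectation a f n q x =
        M.passageExpectation (Set.Ioc ((x : ℝ) - a) x) (fun _ => q) x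
          (fun z => if (z : ℝ) ≤ (x : ℝ) - a then M.drawdownExpectation a f (n - 1) q z else 0) +
        ∑ y ∈ Finset.univ.filter (fun y : S => x < y),
          M.passageExpectation (Set.Ioc ((x : ℝ) - a) x) (fun _ => q) x
            (fun z => if z = y then 1 else 0) * M.drawdownExpectation a f n q y) := by
  refine ⟨M.integrable_drawdownPayoff ha f hq, fun x g => M.integrable_passagePayoff hq _ g x,
    M.drawdownExpectation_zero f, fun n hn x => ?_⟩
  obtain ⟨n, rfl⟩ := Nat.exists_eq_add_of_le' hn
  exact M.drawdownExpectation_succ ha f hq n x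

theorem mainTheorem5 {S : Finset ℝ} (G : Matrix S S ℝ) (hG : IsRateMatrix G)
    {Ω : Type*} [MeasurableSpace Ω] (M : MarkovChain G Ω)
    (a : ℝ) (ha : 0 < a) (f : S → ℂ) (q : ℂ) (hq : 0 < q.re) :
    -- the expectations in the statement are those of integrable random variables
    (∀ (n : ℕ) (x : S), Integrable (M.drawdownPayoff a f n q) (M.P x)) ∧
    (∀ (x : S) (g : S → ℂ),
      Integrable (M.passagePayoff (Set.Ioc ((x : ℝ) - a) x) (fun _ => q) g) (M.P x)) ∧
    -- initial condition
    (∀ x : S, M.drawdownExpectation a f 0 q x = f x) ∧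
    -- linear system
    (∀ n : ℕ, 1 ≤ n → ∀ x : S,
      M.drawdownExpectation a f n q x =
        M.passageExpectation (Set.Ioc ((x : ℝ) - a) x) (fun _ => q) x
          (fun z => if (z : ℝ) ≤ (x : ℝ) - a then M.drawdownExpectation a f (n - 1) q z else 0) +
        ∑ y ∈ Finset.univ.filter (fun y : S => x < y),
          M.passageExpectation (Set.Ioc ((x : ℝ) - a) x) (fun _ => q) x
            (fun z => if z = y then 1 else 0) * M.drawdownExpectation a f n q y) := by
  exact mainTheorem5_general G M a ha f q hq.le
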